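/- Let $F$ be a field, let $n,k\ge 0$ be integers, and let $\mathbb{L}=\mathbb{Z}^n$. For a sublattice (subgroup) $\mathbb{S}\subseteq\mathbb{L}$ let $A_S$ be the $F$-algebra spanned by the monomials $\sigma^x$, $x\in\mathbb{S}$, with $\sigma^x\sigma^y=\sigma^{x+y}$; put $A=A_{\mathbb{L}}=F[\sigma_1^{\pm1},\dots,\sigma_n^{\pm1}]$, so that $A_S\subseteq A$. The ring $A_S$ acts on the space $\mathcal{F}_{\mathbb{S}}$ of all functions $f:\mathbb{S}\to F$ by $(\sigma^x f)(y)=f(y+x)$. For an $A_S$-submodule $Q\subseteq A_S^k$, the system on $\mathbb{S}$ defined by $Q$ is $$\mathrm{Ker}_{\mathcal{F}_{\mathbb{S}}}(Q)=\Big\{(f_1,\dots,f_k)\in\mathcal{F}_{\mathbb{S}}^k \;:\; \sum_{j=1}^k p_jf_j=0\ \text{ for all } (p_1,\dots,p_k)\in Q\Big\}.$$ For a system $\mathcal{B}$ on $\mathbb{S}$ and $T\subseteq\mathbb{S}$, let $\mathcal{B}(T)$ be the set of restrictions to $T$ of the elements of $\mathcal{B}$. The system $\mathcal{B}$ is *controllable*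 if there is a real $\rho>0$ such that $\mathcal{B}(T_1\cup T_2)=\mathcal{B}(T_1)\times\mathcal{B}(T_2)$ for all $T_1,T_2\subseteq\mathbb{S}$ with $\|x_1-x_2\|_1>\rho$ for all $x_1\in T_1$, $x_2\in T_2$. It is *autonomous* if every controllable system $\mathrm{Ker}_{\mathcal{F}_{\mathbb{S}}}(Q')\subseteq\mathcal{B}$ on $\mathbb{S}$, with $Q'$ a submodule of $A_S^k$, is $\{0\}$. **Proposition 7.2.** Let $\mathbb{S}\subseteq\mathbb{L}$ be a sublattice of full rank $n$, let $P\subseteq A^k$ be an $A$-submodule, and let $P^c=P\cap A_S^k$ be its contraction to $A_S^k$. If the system $\mathrm{Ker}_{\mathcal{F}_{\mathbb{L}}}(P)$ on $\mathbb{L}$ is autonomous, then the contracted system $\mathrm{Ker}_{\mathcal{F}_{\mathbb{S}}}(P^c)$ on $\mathbb{S}$ is autonomous. -/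

import Mathlib

/-- The ring of partial difference operators on a lattice `Λ`, with coefficients in `F`: finite
`F`-linear combinations of the monomials (shifts) `σ ^ x`, `x ∈ Λ`, with `σ ^ x * σ ^ y = σ ^ (x + y)`.
For `Λ = ℤⁿ` this is the Laurent polynomial ring `A = F[σ₁, σ₁⁻¹, …, σₙ, σₙ⁻¹]`; for a sublattice
`S` of `ℤⁿ` it is the ring `A_S`, regarded as a subring of `A` through `latticeInclusion`. -/
abbrev DiffRing (F Λ : Type*) [Field F] [AddCommGroup Λ] : Type _ := AddMonoidAlgebra F Λ

/-- The action of a difference operator `a = ∑ c_x σ ^ x` on a signal `f : Λ → F` by shifts: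
`(a f)(y) = ∑ c_x f (y + x)`. -/
noncomputable def shiftAct {F Λ : Type*} [Field F] [AddCommGroup Λ] (a : DiffRing F Λ) (f : Λ → F) : Λ → F :=
  fun y => a.coeff.sum fun x c => c * f (y + x)

/-- The system `Ker(P)` on the lattice `Λ` defined by a submodule `P` of `A_Λ ^ k`: all `k`-tuples of
signals `f = (f_1, …, f_k)` such that `p_1 f_1 + ⋯ + p_k f_k = 0` for every `p ∈ P`. -/
def systemKer {F Λ : Type*} [Field F] [AddCommGroup Λ] {k : ℕ}
    (P : Submodule (DiffRing F Λ) (Fin k → DiffRing F Λ)) : Set (Fin k → Λ → F) :=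
  {f | ∀ p ∈ P, ∑ j, shiftAct (p j) (f j) = 0}

/-- `B(T)`: the set of restrictions to `T` of the trajectories in `B`. -/
def restrictTo {F Λ : Type*} {k : ℕ} (B : Set (Fin k → Λ → F)) (T : Set Λ) :
    Set (Fin k → T → F) :=
  (fun (f : Fin k → Λ → F) (j : Fin k) (x : T) => f j x) '' B

/-- The `L₁` distance on `ℤⁿ`. -/
noncomputable def l1Dist {n : ℕ} (x y : Fin n → ℤ) : ℝ := ∑ i, |((x i - y i : ℤ) : ℝ)|

/-- Controllability of a set `B` of trajectories on a lattice `Λ` lying in `ℤⁿ` through `ι`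
(`ι` is the identity for `ℤⁿ` itself, the inclusion for a sublattice): there is `ρ > 0` such that
`B(T₁ ∪ T₂) = B(T₁) × B(T₂)` for all `T₁, T₂ ⊆ Λ` at `L₁` distance greater than `ρ`
(a condition that holds vacuously when `T₁` or `T₂` is empty). -/
def IsControllable {F Λ : Type*} [AddCommGroup Λ] {n k : ℕ} (ι : Λ →+ (Fin n → ℤ))
    (B : Set (Fin k → Λ → F)) : Prop :=
  ∃ ρ : ℝ, 0 < ρ ∧ ∀ T₁ T₂ : Set Λ, (∀ x ∈ T₁, ∀ y ∈ T₂, ρ < l1Dist (ι x) (ι y)) →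
    restrictTo B (T₁ ∪ T₂) =
      {g | (fun (j : Fin k) (x : T₁) => g j ⟨x, Or.inl x.2⟩) ∈ restrictTo B T₁ ∧
           (fun (j : Fin k) (x : T₂) => g j ⟨x, Or.inr x.2⟩) ∈ restrictTo B T₂}

/-- A system `B` on `Λ` is autonomous if it has no nonzero controllable subsystem, a subsystem being
a system `Ker(P')`, `P'` a submodule of `A_Λ ^ k`, that is contained in `B`. -/
def IsAutonomous {F Λ : Type*} [Field F] [AddCommGroup Λ] {n k : ℕ} (ι : Λ →+ (Fin n → ℤ))
    (B : Set (Fin k → Λ → F)) : Prop :=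
  ∀ P' : Submodule (DiffRing F Λ) (Fin k → DiffRing F Λ),
    systemKer P' ⊆ B → IsControllable ι (systemKer P') → systemKer P' = {0}

/-- The inclusion `A_S → A` of `F`-algebras, sending the monomial of `x ∈ S` to the monomial of
`x ∈ ℤⁿ`. -/
noncomputable def latticeInclusion (F : Type*) [Field F] {n : ℕ} (S : AddSubgroup (Fin n → ℤ)) :
    DiffRing F S →ₐ[F] DiffRing F (Fin n → ℤ) :=
  AddMonoidAlgebra.mapDomainAlgHom F F S.subtype

/-- `A_S → A` is injective. -/
theorem latticeInclusion_injective (F : Type*) [Field F] {n : ℕ} (S : AddSubgroup (Fin n → ℤ)) :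
    Function.Injective (latticeInclusion F S) :=
  AddMonoidAlgebra.mapDomain_injective S.subtype_injective

/-- The image of `A_S` in `A` is the subalgebra generated by the monomials of the points of `S`. -/
theorem latticeInclusion_range (F : Type*) [Field F] {n : ℕ} (S : AddSubgroup (Fin n → ℤ)) :
    (latticeInclusion F S).range =
      Algebra.adjoin F {a | ∃ x ∈ S, a = AddMonoidAlgebra.single x (1 : F)} := by
  apply le_antisymm
  · rintro _ ⟨a, rfl⟩
    induction a using AddMonoidAlgebra.induction_linear with
    | zero => exact (map_zero (latticeInclusion F S)).symm ▸ zero_mem _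
    | add a b ha hb =>
      have h := add_mem ha hb
      rwa [← map_add] at h
    | single x c =>
      have h : latticeInclusion F S (AddMonoidAlgebra.single x c) =
          c • AddMonoidAlgebra.single (x : Fin n → ℤ) (1 : F) := by
        simp [latticeInclusion]
      change latticeInclusion F S (AddMonoidAlgebra.single x c) ∈ _
      rw [h]
      refine Subalgebra.smul_mem _ ?_ c
      refine Algebra.subset_adjoin ?_
      exact ⟨x, x.2, rfl⟩
  · refine Algebra.adjoin_le ?_
    rintro _ ⟨x, hx, rfl⟩
    exact ⟨AddMonoidAlgebra.single (⟨x, hx⟩ : S) (1 : F), by simp [latticeInclusion]⟩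

/-- The contraction `P^c = i⁻¹(P) = P ∩ A_S ^ k` of a submodule `P` of `A ^ k`, where
`i : A_S ^ k → A ^ k` is the coordinatewise inclusion. -/
noncomputable def contraction {F : Type*} [Field F] {n k : ℕ} (S : AddSubgroup (Fin n → ℤ))
    (P : Submodule (DiffRing F (Fin n → ℤ)) (Fin k → DiffRing F (Fin n → ℤ))) :
    Submodule (DiffRing F S) (Fin k → DiffRing F S) where
  carrier := {q | (fun j => latticeInclusion F S (q j)) ∈ P}
  zero_mem' := by
    simp only [Set.mem_ofPred_eq, Pi.zero_apply, map_zero]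
    exact P.zero_mem
  add_mem' := by
    intro p q hp hq
    simp only [Set.mem_ofPred_eq, Pi.add_apply, map_add] at hp hq ⊢
    exact P.add_mem hp hq
  smul_mem' := by
    intro a q hq
    simp only [Set.mem_ofPred_eq, Pi.smul_apply, smul_eq_mul, map_mul] at hq ⊢
    exact P.smul_mem (latticeInclusion F S a) hq

/-! Autonomy of `Ker(P)` amounts to `A ^ k / P` being torsion, and torsion survives contraction. If
some `e_j` is not torsion modulo `P`, a linear form `a` over the domain kills `P` but not `e_j`
(`exists_linearForm_of_not_torsion`). Then `Ker(syzygies a)` lies in `Ker(P)`; it is the image of `g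
↦ (a_i g)` (`systemKer_syzygies`), hence controllable, and nonzero since `a_j ≠ 0`. Conversely, a
nonzero controllable system has a trajectory with a nonzero component of finite support, which no
nonzero operator annihilates (`isAutonomous_of_torsion`). Finally, `A` is an integral extension of
`A_S` when `S` has full rank, so the nonzero ideal of all `c` with `c e_j ∈ P` contains a nonzero
element of `A_S`. -/

/-- The shift action, evaluated at a point, is `F`-linear in the operator. -/
noncomputable def shiftActAt {F Λ : Type*} [Field F] [AddCommGroup Λ] (f : Λ → F) (y : Λ) :
    DiffRing F Λ →ₗ[F] F where
  toFun a := shiftAct a f y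
  map_add' a b := by
    simp only [shiftAct, AddMonoidAlgebra.coeff_add]
    exact Finsupp.sum_add_index' (by simp) (by intros; ring)
  map_smul' c a := by
    simp only [shiftAct, AddMonoidAlgebra.coeff_smul, RingHom.id_apply, smul_eq_mul]
    rw [Finsupp.sum_smul_index (by simp), Finsupp.mul_sum]
    simp [mul_assoc]

/-! ### Shift action, finitely supported signals and image representations -/

section ShiftAction

variable {F Λ : Type*} [Field F] [AddCommGroup Λ]

theorem shiftAct_add_left (a b : DiffRing F Λ) (f : Λ → F) :
    shiftAct (a + b) f = shiftAct a f + shiftAct b f :=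
  funext fun y => (shiftActAt f y).map_add a b

theorem shiftAct_zero_left (f : Λ → F) : shiftAct (0 : DiffRing F Λ) f = 0 :=
  funext fun y => (shiftActAt f y).map_zero

theorem shiftAct_single (x : Λ) (c : F) (f : Λ → F) (y : Λ) :
    shiftAct (AddMonoidAlgebra.single x c) f y = c * f (y + x) := by
  simp [shiftAct]

theorem shiftAct_zero_right (a : DiffRing F Λ) : shiftAct a (0 : Λ → F) = 0 := by
  ext y
  simp [shiftAct]

theorem shiftAct_add_right (a : DiffRing F Λ) (f g : Λ → F) :
    shiftAct a (f + g) = shiftAct a f + shiftAct a g := by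
  ext y
  simp [shiftAct, mul_add, Finsupp.sum_add]

theorem shiftAct_mul (a b : DiffRing F Λ) (f : Λ → F) :
    shiftAct (a * b) f = shiftAct a (shiftAct b f) := by
  induction a using AddMonoidAlgebra.induction_linear with
  | zero => simp [shiftAct_zero_left]
  | add a a' ha ha' => rw [add_mul, shiftAct_add_left, shiftAct_add_left, ha, ha']
  | single x c =>
    induction b using AddMonoidAlgebra.induction_linear with
    | zero => simp [shiftAct_zero_left, shiftAct_zero_right]
    | add b b' hb hb' =>
      rw [mul_add, shiftAct_add_left, shiftAct_add_left, hb, hb', shiftAct_add_right]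
    | single x' c' =>
      ext y
      rw [AddMonoidAlgebra.single_mul_single]
      simp only [shiftAct_single]
      rw [add_assoc, mul_assoc]

theorem shiftAct_congr {a : DiffRing F Λ} {f g : Λ → F} {y : Λ}
    (h : ∀ x ∈ a.coeff.support, f (y + x) = g (y + x)) : shiftAct a f y = shiftAct a g y :=
  Finsupp.sum_congr fun x hx => by rw [h x hx]

theorem shiftAct_sum_left {ι : Type*} (s : Finset ι) (a : ι → DiffRing F Λ) (f : Λ → F) :
    shiftAct (∑ i ∈ s, a i) f = ∑ i ∈ s, shiftAct (a i) f := by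
  ext y
  rw [Finset.sum_apply]
  exact map_sum (shiftActAt f y) a s

theorem exists_shiftAct_ne_zero {a : DiffRing F Λ} (ha : a ≠ 0) :
    ∃ f : Λ → F, shiftAct a f ≠ 0 := by
  classical
  have : a.coeff ≠ 0 := by simpa using ha
  obtain ⟨x, hx⟩ := Finsupp.ne_iff.1 this
  refine ⟨Pi.single x 1, fun h => hx ?_⟩
  have h0 := congrFun h 0
  rw [shiftAct, Finsupp.sum, Finset.sum_eq_single x] at h0
  · simpa using h0
  · intro z _ hz
    simp [hz]
  · intro h
    simp [Finsupp.notMem_support_iff.1 h]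

/-- A finitely supported signal, read as a Laurent polynomial in the inverse shifts, satisfies no
nonzero difference equation when the ring of operators has no zero divisors. -/
theorem eq_zero_of_shiftAct_eq_zero_of_finite_support [NoZeroDivisors (DiffRing F Λ)]
    {a : DiffRing F Λ} (ha : a ≠ 0) {g : Λ → F} (hg : (Function.support g).Finite)
    (h : shiftAct a g = 0) : g = 0 := by
  classical
  have hfin : (Function.support fun x => g (-x)).Finite := by
    have := hg.preimage (neg_injective (G := Λ)).injOn
    exact this.subset fun x hx => hx
  let b : DiffRing F Λ := AddMonoidAlgebra.ofCoeff (Finsupp.ofSupportFinite (fun x => g (-x)) hfin)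
  have hb : ∀ x, b.coeff x = g (-x) := fun x => rfl
  -- Reflecting the signal turns the shift action into multiplication in the ring.
  have hmul : ∀ (c : DiffRing F Λ) y, (c * b).coeff y = shiftAct c g (-y) := by
    intro c y
    induction c using AddMonoidAlgebra.induction_linear with
    | zero => simp [shiftAct_zero_left]
    | add c c' hc hc' => simp [add_mul, shiftAct_add_left, hc, hc']
    | single x r =>
      rw [AddMonoidAlgebra.coeff_single_mul_apply, hb, shiftAct_single]
      simp [add_comm]
  have hab : a * b = 0 := by
    apply AddMonoidAlgebra.coeff_injective
    ext y
    simp [hmul, h]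
  have hb0 : b = 0 := (mul_eq_zero.1 hab).resolve_left ha
  ext x
  have := hb (-x)
  rw [hb0] at this
  simpa using this.symm

theorem zero_mem_systemKer {k : ℕ} (P : Submodule (DiffRing F Λ) (Fin k → DiffRing F Λ)) :
    (0 : Fin k → Λ → F) ∈ systemKer P := fun p _ => by
  simp [shiftAct_zero_right]

theorem shiftAct_eq_zero_of_single_mem {k : ℕ}
    {P : Submodule (DiffRing F Λ) (Fin k → DiffRing F Λ)} {f : Fin k → Λ → F}
    (hf : f ∈ systemKer P) {j : Fin k} {a : DiffRing F Λ} (ha : Pi.single j a ∈ P) :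
    shiftAct a (f j) = 0 := by
  have := hf _ ha
  rw [Finset.sum_eq_single j] at this
  · simpa using this
  · intro i _ hi
    simp [hi, shiftAct_zero_left]
  · simp

/-- The relations `p₁ a₁ + ⋯ + p_k a_k = 0` between the entries of `a`. -/
noncomputable def syzygies {k : ℕ} (a : Fin k → DiffRing F Λ) :
    Submodule (DiffRing F Λ) (Fin k → DiffRing F Λ) :=
  LinearMap.ker (Fintype.linearCombination (DiffRing F Λ) a)

theorem mem_syzygies {k : ℕ} {a p : Fin k → DiffRing F Λ} :
    p ∈ syzygies a ↔ ∑ j, p j * a j = 0 := by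
  simp [syzygies, Fintype.linearCombination_apply]

/-- The system defined by the syzygies of `a` has the image representation `g ↦ (a₁ g, …, a_k g)`;
this is the injectivity of the signal module `Hom_F(A, F)`. -/
theorem systemKer_syzygies {k : ℕ} (a : Fin k → DiffRing F Λ) :
    systemKer (syzygies a) = Set.range fun (g : Λ → F) j => shiftAct (a j) g := by
  ext f
  constructor
  · intro hf
    let φ : (Fin k → DiffRing F Λ) →ₗ[F] DiffRing F Λ :=
      (Fintype.linearCombination (DiffRing F Λ) a).restrictScalars F
    have hφ : ∀ p, φ p = ∑ j, p j * a j := fun p => by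
      simp [φ, Fintype.linearCombination_apply]
    -- A tuple of signals is encoded as a functional on `A ^ k`: apply an operator row, evaluate at
    -- `0`.
    let G : (Fin k → DiffRing F Λ) →ₗ[F] F :=
      ∑ j, (shiftActAt (f j) 0) ∘ₗ LinearMap.proj j
    have hG : ∀ p, G p = (∑ j, shiftAct (p j) (f j)) 0 := fun p => by
      simp [G, shiftActAt]
    -- `G` vanishes on `ker φ`, so by vector space duality it factors as `lam ∘ φ`; the values of
    -- `lam` on monomials form the input signal.
    have hmem : G ∈ LinearMap.range φ.dualMap := by
      rw [LinearMap.range_dualMap_eq_dualAnnihilator_ker, Submodule.mem_dualAnnihilator]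
      intro p hp
      rw [LinearMap.mem_ker, hφ] at hp
      rw [hG, hf p (mem_syzygies.2 hp)]
      rfl
    obtain ⟨lam, hlam⟩ := hmem
    have hact : ∀ (c : DiffRing F Λ) y,
        shiftAct c (fun x => lam (AddMonoidAlgebra.single x 1)) y =
          lam (AddMonoidAlgebra.single y 1 * c) := by
      intro c y
      induction c using AddMonoidAlgebra.induction_linear with
      | zero => simp [shiftAct_zero_left]
      | add c c' hc hc' => simp [mul_add, shiftAct_add_left, hc, hc']
      | single x r =>
        rw [shiftAct_single, AddMonoidAlgebra.single_mul_single, one_mul, ← smul_eq_mul,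
          ← map_smul, AddMonoidAlgebra.smul_single, smul_eq_mul, mul_one]
    refine ⟨fun x => lam (AddMonoidAlgebra.single x 1), ?_⟩
    ext j y
    -- Testing on `σ ^ y e_j` reads off `f j y`.
    have h1 := LinearMap.congr_fun hlam (Pi.single j (AddMonoidAlgebra.single y 1))
    rw [LinearMap.dualMap_apply, hφ, hG, Finset.sum_apply, Finset.sum_eq_single j,
      Finset.sum_eq_single j] at h1
    · refine (hact (a j) y).trans ?_
      simpa [shiftAct_single] using h1
    · intro i _ hi
      simp [hi, shiftAct_zero_left]
    · simp
    · intro i _ hi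
      simp [hi]
    · simp
  · rintro ⟨g, rfl⟩ p hp
    simp only [← shiftAct_mul, ← shiftAct_sum_left]
    rw [mem_syzygies.1 hp, shiftAct_zero_left]

end ShiftAction

/-! ### Controllability, and torsion implies autonomy -/

section Controllability

variable {F Λ : Type*} [Field F] [AddCommGroup Λ] {n k : ℕ}

theorem l1Dist_eq_of_sub_eq {x y x' y' : Fin n → ℤ} (h : x - y = x' - y') :
    l1Dist x y = l1Dist x' y' :=
  Finset.sum_congr rfl fun i _ => by
    have : x i - y i = x' i - y' i := congrFun h i
    rw [this]

theorem finite_setOf_l1Dist_le (x : Fin n → ℤ) (ρ : ℝ) : {y | l1Dist x y ≤ ρ}.Finite := by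
  have hbox : (Set.Icc (fun i => x i - ⌈ρ⌉) (fun i => x i + ⌈ρ⌉)).Finite := Set.finite_Icc _ _
  refine hbox.subset fun y hy => ?_
  have key : ∀ i, |x i - y i| ≤ ⌈ρ⌉ := fun i => by
    have h1 : |((x i - y i : ℤ) : ℝ)| ≤ l1Dist x y :=
      Finset.single_le_sum (f := fun i => |((x i - y i : ℤ) : ℝ)|)
        (fun _ _ => abs_nonneg _) (Finset.mem_univ i)
    have h2 : ((|x i - y i| : ℤ) : ℝ) ≤ (⌈ρ⌉ : ℤ) := by
      rw [Int.cast_abs]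
      exact h1.trans (hy.trans (Int.le_ceil ρ))
    exact_mod_cast h2
  constructor
  · intro i
    have := abs_le.1 (key i)
    dsimp only
    omega
  · intro i
    have := abs_le.1 (key i)
    dsimp only
    omega

theorem exists_l1Dist_le_of_finset (ι : Λ →+ (Fin n → ℤ)) (D : Finset Λ) :
    ∃ R : ℝ, 0 ≤ R ∧ ∀ x ∈ D, ∀ y ∈ D, l1Dist (ι x) (ι y) ≤ R := by
  have hfin := ((D ×ˢ D).finite_toSet.image fun p : Λ × Λ => l1Dist (ι p.1) (ι p.2)).bddAbove
  obtain ⟨R, hR⟩ := hfin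
  refine ⟨max R 0, le_max_right _ _, fun x hx y hy => le_max_of_le_left (hR ?_)⟩
  exact ⟨(x, y), by simp [hx, hy], rfl⟩

/-- A system with an image representation is controllable: cut off the input. -/
theorem isControllable_range_shiftAct (ι : Λ →+ (Fin n → ℤ)) (a : Fin k → DiffRing F Λ) :
    IsControllable ι (Set.range fun (g : Λ → F) j => shiftAct (a j) g) := by
  classical
  obtain ⟨D, hD⟩ : ∃ D : Finset Λ, ∀ j, ∀ x ∈ (a j).coeff.support, x ∈ D :=
    ⟨Finset.univ.biUnion fun j => (a j).coeff.support, fun j x hx =>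
      Finset.mem_biUnion.2 ⟨j, Finset.mem_univ j, hx⟩⟩
  obtain ⟨R, hR0, hR⟩ := exists_l1Dist_le_of_finset ι D
  -- `R` bounds the diameter of the supports; adding `1` makes the constant positive.
  refine ⟨R + 1, by linarith, fun T₁ T₂ hT => ?_⟩
  ext g
  constructor
  · rintro ⟨f, hf, hfg⟩
    subst hfg
    exact ⟨⟨f, hf, rfl⟩, ⟨f, hf, rfl⟩⟩
  · rintro ⟨⟨f₁, ⟨g₁, hg₁⟩, h₁⟩, ⟨f₂, ⟨g₂, hg₂⟩, h₂⟩⟩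
    subst hg₁ hg₂
    -- `U = T₁ + D` contains every input point seen from `T₁`; it misses `T₂ + D`, since `y + x = y'
    -- + x'` would put `y` and `y'` within `R`.
    let U : Set Λ := {z | ∃ y ∈ T₁, ∃ x ∈ D, z = y + x}
    let f : Λ → F := fun z => if z ∈ U then g₁ z else g₂ z
    refine ⟨fun j => shiftAct (a j) f, ⟨f, rfl⟩, ?_⟩
    ext j ⟨y, hy⟩
    change shiftAct (a j) f y = g j ⟨y, hy⟩
    rcases hy with hy | hy
    · have e : shiftAct (a j) g₁ y = g j ⟨y, Or.inl hy⟩ := congrFun (congrFun h₁ j) ⟨y, hy⟩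
      rw [← e]
      refine shiftAct_congr fun x hx => ?_
      exact if_pos ⟨y, hy, x, hD j x hx, rfl⟩
    · have e : shiftAct (a j) g₂ y = g j ⟨y, Or.inr hy⟩ := congrFun (congrFun h₂ j) ⟨y, hy⟩
      rw [← e]
      refine shiftAct_congr fun x hx => ?_
      refine if_neg ?_
      rintro ⟨y', hy', x', hx', hyx⟩
      have h3 := hT y' hy' y hy
      have h4 : l1Dist (ι y') (ι y) = l1Dist (ι x) (ι x') := by
        apply l1Dist_eq_of_sub_eq
        rw [← map_sub, ← map_sub]
        congr 1
        rw [sub_eq_sub_iff_add_eq_add, ← hyx, add_comm]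
      have h5 := hR x (hD j x hx) x' hx'
      linarith

/-- A nonzero controllable system contains a nonzero trajectory that vanishes off a finite set. -/
theorem IsControllable.exists_finite_support {ι : Λ →+ (Fin n → ℤ)} (hι : Function.Injective ι)
    {B : Set (Fin k → Λ → F)} (hB : IsControllable ι B) (h0 : 0 ∈ B) {f : Fin k → Λ → F}
    (hf : f ∈ B) (j : Fin k) (x : Λ) :
    ∃ g ∈ B, g j x = f j x ∧ (Function.support (g j)).Finite := by
  obtain ⟨ρ, hρ, h⟩ := hB
  have hT : ∀ u ∈ ({x} : Set Λ), ∀ v ∈ {v | ρ < l1Dist (ι x) (ι v)}, ρ < l1Dist (ι u) (ι v) := by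
    rintro u rfl v hv
    exact hv
  have hx : x ∉ {v | ρ < l1Dist (ι x) (ι v)} := by
    have : l1Dist (ι x) (ι x) = 0 := by simp [l1Dist]
    simp only [Set.mem_ofPred_eq, this, not_lt]
    exact hρ.le
  classical
  -- Patch `f` at `x` with `0` at all points farther than `ρ`; the resulting trajectory lives in a
  -- ball, which is finite.
  have hmem : (fun (i : Fin k) (z : ↥({x} ∪ {v | ρ < l1Dist (ι x) (ι v)} : Set Λ)) =>
      if z.1 = x then f i x else 0) ∈ restrictTo B ({x} ∪ {v | ρ < l1Dist (ι x) (ι v)}) := by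
    rw [h _ _ hT]
    refine ⟨⟨f, hf, ?_⟩, ⟨0, h0, ?_⟩⟩
    · ext i ⟨z, hz⟩
      obtain rfl : z = x := hz
      simp
    · ext i ⟨z, hz⟩
      have : z ≠ x := fun e => hx (e ▸ hz)
      simp [this]
  obtain ⟨g, hg, hgr⟩ := hmem
  refine ⟨g, hg, ?_, ?_⟩
  · have := congrFun (congrFun hgr j) ⟨x, Or.inl rfl⟩
    simpa using this
  · have hfin := (finite_setOf_l1Dist_le (ι x) ρ).preimage hι.injOn
    refine hfin.subset fun z hz => ?_
    by_contra hzn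
    have hz2 : z ∈ {v | ρ < l1Dist (ι x) (ι v)} := by
      simpa using hzn
    have e := congrFun (congrFun hgr j) ⟨z, Or.inr hz2⟩
    have hzx : z ≠ x := fun e => hx (e ▸ hz2)
    exact hz (by simpa [hzx] using e)

/-- A system whose module `A ^ k / P` is torsion is autonomous. -/
theorem isAutonomous_of_torsion [NoZeroDivisors (DiffRing F Λ)] {ι : Λ →+ (Fin n → ℤ)}
    (hι : Function.Injective ι) {P : Submodule (DiffRing F Λ) (Fin k → DiffRing F Λ)}
    (hP : ∀ j, ∃ c : DiffRing F Λ, c ≠ 0 ∧ Pi.single j c ∈ P) :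
    IsAutonomous ι (systemKer P) := by
  intro P' hP' hc
  refine Set.Subset.antisymm (fun f hf => ?_) (Set.singleton_subset_iff.2 (zero_mem_systemKer P'))
  rw [Set.mem_singleton_iff]
  ext j x
  obtain ⟨g, hg, hgx, hfin⟩ := hc.exists_finite_support hι (zero_mem_systemKer P') hf j x
  obtain ⟨c, hc0, hcP⟩ := hP j
  have := eq_zero_of_shiftAct_eq_zero_of_finite_support hc0 hfin
    (shiftAct_eq_zero_of_single_mem (hP' hg) hcP)
  rw [← hgx, this]
  rfl

end Controllability

/-! ### Linear forms detecting non-torsion elements -/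

/-- If `e_j` is not a torsion element modulo `P`, some linear form over the domain `R` vanishes on
`P` but not on `e_j`. -/
theorem exists_linearForm_of_not_torsion {R : Type*} (K : Type*) [CommRing R] [IsDomain R]
    [Field K] [Algebra R K] [IsFractionRing R K] {k : ℕ}
    (P : Submodule R (Fin k → R)) (j : Fin k) (hj : ∀ c, Pi.single j c ∈ P → c = 0) :
    ∃ a : Fin k → R, a j ≠ 0 ∧ ∀ p ∈ P, ∑ i, p i * a i = 0 := by
  let i : (Fin k → R) → (Fin k → K) := fun p l => algebraMap R K (p l)
  have hi : Function.Injective i := fun p q h =>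
    funext fun l => IsFractionRing.injective R K (congrFun h l)
  let W : Submodule K (Fin k → K) := Submodule.span K (i '' P)
  -- Clearing denominators: each vector of the `K`-span has a nonzero `R`-multiple in `P`.
  have hW : ∀ v ∈ W, ∃ c : R, c ≠ 0 ∧ ∃ p ∈ P, i p = algebraMap R K c • v := by
    intro v hv
    induction hv using Submodule.span_induction with
    | mem v hv =>
      obtain ⟨p, hp, rfl⟩ := hv
      exact ⟨1, one_ne_zero, p, hp, by simp⟩
    | zero => exact ⟨1, one_ne_zero, 0, P.zero_mem, by ext; simp [i]⟩
    | add v w _ _ hv hw =>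
      obtain ⟨c, hc, p, hp, hpv⟩ := hv
      obtain ⟨d, hd, q, hq, hqw⟩ := hw
      refine ⟨c * d, mul_ne_zero hc hd, d • p + c • q,
        P.add_mem (P.smul_mem d hp) (P.smul_mem c hq), ?_⟩
      ext l
      have h1 : algebraMap R K (p l) = algebraMap R K c * v l := congrFun hpv l
      have h2 : algebraMap R K (q l) = algebraMap R K d * w l := congrFun hqw l
      simp only [i, Pi.add_apply, Pi.smul_apply, smul_eq_mul, map_add, map_mul, h1, h2]
      ring
    | smul r v _ hv =>
      obtain ⟨c, hc, p, hp, hpv⟩ := hv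
      obtain ⟨x, y, hy, rfl⟩ := IsFractionRing.div_surjective (A := R) r
      have hy0 : y ≠ 0 := nonZeroDivisors.ne_zero hy
      refine ⟨y * c, mul_ne_zero hy0 hc, x • p, P.smul_mem x hp, ?_⟩
      ext l
      have h1 : algebraMap R K (p l) = algebraMap R K c * v l := congrFun hpv l
      have hy' : algebraMap R K y ≠ 0 := by simpa using hy0
      simp only [i, Pi.smul_apply, smul_eq_mul, map_mul, h1]
      field_simp
  have hnot : Pi.single j (1 : K) ∉ W := by
    intro hmem
    obtain ⟨c, hc, p, hp, hpv⟩ := hW _ hmem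
    refine hc (hj c ?_)
    have : p = Pi.single j c := by
      apply hi
      rw [hpv]
      ext l
      by_cases hl : l = j
      · subst hl
        simp [i]
      · simp [i, hl]
    rwa [← this]
  obtain ⟨ψ, hψ, hker⟩ := Submodule.exists_le_ker_of_notMem hnot
  -- With a common denominator `b`, the form is `a l = b * ψ(e_l)`.
  obtain ⟨b, hb⟩ := IsLocalization.exist_integer_multiples_of_finite (nonZeroDivisors R)
    fun l => ψ (Pi.single l (1 : K))
  choose a ha using hb
  have hb0 : algebraMap R K b ≠ 0 := by simp
  refine ⟨a, fun h => ?_, fun p hp => ?_⟩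
  · have := ha j
    rw [h, map_zero, Algebra.smul_def] at this
    exact mul_ne_zero hb0 hψ this.symm
  · apply IsFractionRing.injective R K
    have h0 : ψ (i p) = 0 := hker (Submodule.subset_span ⟨p, hp, rfl⟩)
    rw [LinearMap.pi_apply_eq_sum_univ] at h0
    have h1 : ∀ l : Fin k, (fun m => if l = m then (1 : K) else 0) = Pi.single l 1 := fun l => by
      ext m
      simp [Pi.single_apply, eq_comm (a := l)]
    simp only [map_sum, map_mul, map_zero, ha, Algebra.smul_def]
    rw [← mul_zero (algebraMap R K b), ← h0, Finset.mul_sum]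
    refine Finset.sum_congr rfl fun l _ => ?_
    rw [h1, smul_eq_mul]
    ring

/-! ### Autonomy implies torsion; integrality over a full-rank sublattice -/

section Lattice

variable {F : Type*} [Field F] {n k : ℕ}

/-- The module `A ^ k / P` of an autonomous system is torsion. -/
theorem IsAutonomous.exists_single_mem {Λ : Type*} [AddCommGroup Λ] [IsDomain (DiffRing F Λ)]
    {ι : Λ →+ (Fin n → ℤ)} {P : Submodule (DiffRing F Λ) (Fin k → DiffRing F Λ)}
    (hP : IsAutonomous ι (systemKer P)) (j : Fin k) :
    ∃ c : DiffRing F Λ, c ≠ 0 ∧ Pi.single j c ∈ P := by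
  by_contra! hj
  obtain ⟨a, haj, ha⟩ := exists_linearForm_of_not_torsion (FractionRing (DiffRing F Λ)) P j fun c hc =>
    by_contra fun h => hj c h hc
  have hle : P ≤ syzygies a := fun p hp => mem_syzygies.2 (ha p hp)
  have hz := hP (syzygies a) (fun f hf p hp => hf p (hle hp))
    (by rw [systemKer_syzygies]; exact isControllable_range_shiftAct ι a)
  rw [systemKer_syzygies] at hz
  obtain ⟨g, hg⟩ := exists_shiftAct_ne_zero haj
  have hmem : (fun i => shiftAct (a i) g) ∈ ({0} : Set (Fin k → Λ → F)) := by
    rw [← hz]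
    exact ⟨g, rfl⟩
  exact hg (congrFun hmem j)

/-- Full rank makes the quotient finite, and the index of `S` annihilates it. -/
theorem exists_nsmul_mem_of_finrank_eq {S : AddSubgroup (Fin n → ℤ)}
    (hS : Module.finrank ℤ S = n) : ∃ m : ℕ, 0 < m ∧ ∀ x, m • x ∈ S := by
  have hfin : Finite ((Fin n → ℤ) ⧸ S.toIntSubmodule) :=
    Submodule.finiteQuotientOfFreeOfRankEq _ (by
      rw [Module.finrank_fin_fun]
      exact hS)
  have : Finite ((Fin n → ℤ) ⧸ S) := hfin
  have : S.FiniteIndex := AddSubgroup.finiteIndex_of_finite_quotient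
  exact ⟨S.index, Nat.pos_of_ne_zero AddSubgroup.FiniteIndex.index_ne_zero,
    S.nsmul_index_mem⟩

/-- The `m`-th power of a monomial at `x` is a monomial at `m • x ∈ S`, and sums of integral
elements are integral. -/
theorem latticeInclusion_isIntegral {S : AddSubgroup (Fin n → ℤ)}
    (hS : Module.finrank ℤ S = n) : (latticeInclusion F S).toRingHom.IsIntegral := by
  obtain ⟨m, hm, hmS⟩ := exists_nsmul_mem_of_finrank_eq hS
  intro a
  induction a using AddMonoidAlgebra.induction_linear with
  | zero => exact (latticeInclusion F S).toRingHom.isIntegralElem_zero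
  | add a b ha hb => exact ha.add _ hb
  | single x c =>
    let _ := (latticeInclusion F S).toRingHom.toAlgebra
    change IsIntegral (DiffRing F S) _
    refine IsIntegral.of_pow hm ?_
    have : AddMonoidAlgebra.single x c ^ m = algebraMap (DiffRing F S) (DiffRing F (Fin n → ℤ))
        (AddMonoidAlgebra.single ⟨m • x, hmS x⟩ (c ^ m)) := by
      rw [AddMonoidAlgebra.single_pow]
      change _ = latticeInclusion F S _
      simp [latticeInclusion]
    rw [this]
    exact isIntegral_algebraMap

/-- Over a sublattice of full rank every nonzero ideal of `A` meets `A_S` nontrivially. -/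
theorem exists_latticeInclusion_mem {S : AddSubgroup (Fin n → ℤ)}
    (hS : Module.finrank ℤ S = n) {I : Ideal (DiffRing F (Fin n → ℤ))}
    {c : DiffRing F (Fin n → ℤ)} (hc : c ≠ 0) (hcI : c ∈ I) :
    ∃ b : DiffRing F S, b ≠ 0 ∧ latticeInclusion F S b ∈ I := by
  let _ := (latticeInclusion F S).toRingHom.toAlgebra
  have h := Ideal.comap_ne_bot_of_integral_mem (R := DiffRing F S) hc hcI
    (latticeInclusion_isIntegral hS c)
  obtain ⟨b, hb, hb0⟩ := Submodule.exists_mem_ne_zero_of_ne_bot h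
  exact ⟨b, hb0, hb⟩

end Lattice

theorem proposition7p2 {F : Type*} [Field F] (n k : ℕ) (S : AddSubgroup (Fin n → ℤ))
    (hS : Module.finrank ℤ S = n)
    (P : Submodule (DiffRing F (Fin n → ℤ)) (Fin k → DiffRing F (Fin n → ℤ)))
    (hP : IsAutonomous (AddMonoidHom.id (Fin n → ℤ)) (systemKer P)) :
    IsAutonomous S.subtype (systemKer (contraction S P)) := by
  have : NoZeroDivisors (DiffRing F S) :=
    (latticeInclusion_injective F S).noZeroDivisors _ (map_zero _) (map_mul _)
  refine isAutonomous_of_torsion S.subtype_injective fun j => ?_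
  obtain ⟨c, hc, hcP⟩ := hP.exists_single_mem j
  -- The annihilator of the class of `e_j` in `A ^ k / P`.
  let I : Ideal (DiffRing F (Fin n → ℤ)) :=
    P.comap (LinearMap.single (DiffRing F (Fin n → ℤ)) (fun _ => DiffRing F (Fin n → ℤ)) j)
  obtain ⟨b, hb, hbP⟩ := exists_latticeInclusion_mem hS (I := I) hc hcP
  refine ⟨b, hb, ?_⟩
  change (fun l => latticeInclusion F S ((Pi.single j b : Fin k → DiffRing F S) l)) ∈ P
  have : (fun l => latticeInclusion F S ((Pi.single j b : Fin k → DiffRing F S) l)) =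
      Pi.single j (latticeInclusion F S b) := by
    ext1 l
    exact Pi.apply_single (fun _ => latticeInclusion F S) (fun _ => map_zero _) j b l
  rw [this]
  exact hbP
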